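/- Let $\mathbb{F}_q$ be a finite field and let $K\ge 3$, $0\le T\le K-3$ and $1\le G\le K$ be integers. For block lengths $L\ge 1$ and $L_X,L_S\ge 0$, each user $k\in[K]$ holds an input $W_k$ uniform on $\mathbb{F}_q^{L}$, and each group $\mathcal{G}\subseteq[K]$ with $|\mathcal{G}|=G$ is assigned a key $S_{\mathcal{G}}$ uniform on $\mathbb{F}_q^{L_S}$; all inputs and all keys are mutually independent. User $k$ knows $W_k$ and $Z_k=(S_{\mathcal{G}})_{\mathcal{G}\ni k}$ and broadcasts $X_k\in\mathbb{F}_q^{L_X}$, a deterministic function of $(W_k,Z_k)$. A scheme (a choice of $L,L_X,L_S$ and of these functions) is valid if for every $k\in[K]$ $$H\Big(\sum_{i=1}^K W_i\,\Big|\,(X_i)_{i\ne k},W_k,Z_k\Big)=0$$ and, for every $\mathcal{T}\subseteq[K]\setminus\{k\}$ with $|\mathcal{T}|\le T$, $$I\Big((X_i)_{i\neq k};(W_i)_{i\ne k}\,\Big|\,\sum_{i=1}^K W_i,\,W_k,Z_k,(W_i,Z_i)_{i\in\mathcal{T}}\Big)=0 .$$ A pair $(R_X,R_S)\in\mathbb{R}^2$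 is achievable if there is a valid scheme with $L_X/L\le R_X$ and $L_S/L\le R_S$, and the capacity region $\mathcal{R}^*$ is the closure in $\mathbb{R}^2$ of the set of achievable pairs. Then $\mathcal{R}^*=\emptyset$ if $G=1$ or $G\ge K-T$, and if $2\le G<K-T$, then $$\mathcal{R}^*=\Big\{(R_X,R_S):\ R_X\ge 1,\ R_S\ge \frac{K-T-2}{\binom{K-T-1}{G}}\Big\}.$$ -/

import Mathlib

namespace SecureAgg

noncomputable section

/-! ### Shannon entropy of finite-valued random variables

Entropies are in nats. Every constraint below says that an entropy or a mutual information
is zero, so the base of the logarithm plays no role. -/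

/-- Shannon entropy `H(X) = -∑ₓ P(X = x) log P(X = x)`. -/
def entropy {Ω α : Type*} [Fintype α] (P : PMF Ω) (X : Ω → α) : ℝ :=
  ∑ x : α, Real.negMulLog ((P.map X) x).toReal

/-- Conditional entropy `H(X | Y) = H(X, Y) - H(Y)`. -/
def condEntropy {Ω α β : Type*} [Fintype α] [Fintype β] (P : PMF Ω)
    (X : Ω → α) (Y : Ω → β) : ℝ :=
  entropy P (fun ω => (X ω, Y ω)) - entropy P Y

/-- Conditional mutual information `I(X; Y | Z) = H(X | Z) - H(X | Y, Z)`. -/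
def condMutualInfo {Ω α β γ : Type*} [Fintype α] [Fintype β] [Fintype γ] (P : PMF Ω)
    (X : Ω → α) (Y : Ω → β) (Z : Ω → γ) : ℝ :=
  condEntropy P X Z - condEntropy P X (fun ω => (Y ω, Z ω))

/-! ### The source: inputs and groupwise keys -/

/-- The groups: all `G`-element subsets of the `K` users. -/
abbrev UserGroup (K G : ℕ) : Type := {𝒢 : Finset (Fin K) // 𝒢.card = G}

/-- Values of the individual key `Z_k`: one block of `LS` symbols for every group containing
user `k`. -/
abbrev IndivKey (F : Type*) (K G LS : ℕ) (k : Fin K) : Type _ :=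
  ∀ _ : {𝒢 : UserGroup K G // k ∈ 𝒢.1}, (Fin LS → F)

/-- The sample space: all inputs `(W_k)_k`, of `L` symbols each, together with all group keys
`(S_𝒢)_𝒢`, of `LS` symbols each. -/
abbrev Sample (F : Type*) (K G L LS : ℕ) : Type _ :=
  (Fin K → Fin L → F) × (UserGroup K G → Fin LS → F)

/-- The joint law of inputs and group keys: uniform on the whole product, that is, all symbols
of all inputs and of all group keys are independent and uniform over `F`. -/
def law (F : Type*) [Field F] [Fintype F] (K G L LS : ℕ) : PMF (Sample F K G L LS) :=
  PMF.uniformOfFintype (Sample F K G L LS)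

section Variables

variable {F : Type*} {K G L LS : ℕ}

/-- The input `W_k` of user `k`. -/
def input (k : Fin K) (ω : Sample F K G L LS) : Fin L → F := ω.1 k

/-- The individual key `Z_k = {S_𝒢 : k ∈ 𝒢}` of user `k`. -/
def indivKey (k : Fin K) (ω : Sample F K G L LS) : IndivKey F K G LS k := fun 𝒢 => ω.2 𝒢.1

/-- The sum `W_1 + ⋯ + W_K` of all inputs. -/
def inputSum [Field F] (ω : Sample F K G L LS) : Fin L → F := ∑ i : Fin K, input i ω

end Variables

/-! ### Schemes -/

/-- A scheme with inputs of `L` symbols, messages of `LX` symbols and group keys of `LS` symbols: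
user `k` maps its input and its individual key to its message. -/
structure Scheme (F : Type*) (K G L LX LS : ℕ) where
  /-- The encoding function of each user. -/
  encode : ∀ k : Fin K, (Fin L → F) → IndivKey F K G LS k → (Fin LX → F)

namespace Scheme

variable {F : Type*} {K G L LX LS : ℕ}

/-- The message `X_k` broadcast by user `k`. -/
def message (σ : Scheme F K G L LX LS) (k : Fin K) (ω : Sample F K G L LS) : Fin LX → F :=
  σ.encode k (input k ω) (indivKey k ω)

/-- The messages `{X_i}_{i ≠ k}` received by user `k`. -/
def received (σ : Scheme F K G L LX LS) (k : Fin K) (ω : Sample F K G L LS) :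
    ∀ _ : {i : Fin K // i ≠ k}, (Fin LX → F) := fun i => σ.message i.1 ω

/-- Recovery: `H(W_1 + ⋯ + W_K | {X_i}_{i ≠ k}, W_k, Z_k) = 0` for every user `k`. -/
def Recovery [Field F] [Fintype F] (σ : Scheme F K G L LX LS) : Prop :=
  ∀ k : Fin K,
    condEntropy (law F K G L LS) inputSum
      (fun ω => (σ.received k ω, input k ω, indivKey k ω)) = 0

/-- Security against every user `k` that colludes with a set `𝒯 ⊆ [K] \ {k}` of at most `T`
other users:
`I({X_i}_{i ≠ k}; {W_i}_{i ≠ k} | W_1 + ⋯ + W_K, W_k, Z_k, {W_i, Z_i}_{i ∈ 𝒯}) = 0`. -/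
def Security [Field F] [Fintype F] (σ : Scheme F K G L LX LS) (T : ℕ) : Prop :=
  ∀ (k : Fin K) (𝒯 : Finset (Fin K)), k ∉ 𝒯 → 𝒯.card ≤ T →
    condMutualInfo (law F K G L LS)
      (σ.received k)
      (fun ω (i : {i : Fin K // i ≠ k}) => input i.1 ω)
      (fun ω => (inputSum ω, input k ω, indivKey k ω,
        fun i : {i : Fin K // i ∈ 𝒯} => (input i.1 ω, indivKey i.1 ω))) = 0

end Scheme

/-! ### The capacity region -/

/-- `(R_X, R_S)` is achievable if some scheme, for some input length `L ≥ 1`, satisfies recovery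
and security and has rates `LX / L ≤ R_X` and `LS / L ≤ R_S`. -/
def Achievable (F : Type*) [Field F] [Fintype F] (K T G : ℕ) (R : ℝ × ℝ) : Prop :=
  ∃ (L LX LS : ℕ) (σ : Scheme F K G L LX LS),
    0 < L ∧ σ.Recovery ∧ σ.Security T ∧
      (LX : ℝ) / (L : ℝ) ≤ R.1 ∧ (LS : ℝ) / (L : ℝ) ≤ R.2

/-- The optimal rate region: the closure of the set of achievable pairs `(R_X, R_S)`. -/
def capacityRegion (F : Type*) [Field F] [Fintype F] (K T G : ℕ) : Set (ℝ × ℝ) :=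
  closure {R : ℝ × ℝ | Achievable F K T G R}

end

end SecureAgg

/-!
# The capacity region of decentralized secure aggregation with groupwise keys

Under the uniform law `H(X | Y) = 0` says that `Y` determines `X`, and `I(X; Y | Z) = 0` is
conditional independence (`condMutualInfo_uniform_eq_zero_iff`, the equality case of the Gibbs
inequality). The lower bounds only use the supports of the laws, so they are counting arguments.

*Lower bounds.* With all keys fixed, recovery makes each message an injective function of the input
of its sender, so `L ≤ LX`. Let `U` consist of the `K - T - 1` users outside a coalition formed by
the recovering user and `T` others. With all keys zero, the zero-sum inputs on `U` produce
`q ^ ((K - T - 2) L)` distinct families of messages. By security each of these families also arises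
from zero inputs, with the keys known to the coalition unchanged, hence from one of the
`q ^ (C(K - T - 1, G) LS)` choices of the keys of the groups inside `U`
(`Scheme.Security.le_keyLength`). If `G ≥ K - T` there are no such groups, and the bound is
contradictory. For `G = 1` no user knows anything about another user's key, so recovery forces a
message to determine its input whatever the key, against security
(`Scheme.Security.not_recovery_of_private_keys`).

*Achievability.* User `k` sends its input plus linear images of its keys, with coefficients that sum
to zero over the users of each group; the messages then add up to the sum of the inputs. Such a
scheme is secure if the keys inside every `U` of size `u = K - T - 1` can produce all zero-sum
values on `U` (`Scheme.masking_security`; larger `U` follow by `KeysSpan.of_card_le`). For the block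
lengths `u C(u - 2, G - 2)` and `G (G - 1)`, which have the optimal ratio, this is the
nonvanishing of one determinant for each `U`. Each determinant is a nonzero polynomial in
parameters of the coefficients: with one star on `U` for every input symbol, double counting
matches the edges of all stars with the key symbols so that every edge lies inside the group of its key symbol
(`exists_star_design`), and letting each key symbol act along its edge alone gives the identity
matrix. So all the determinants are nonzero at a common point over the algebraic closure,
hence over a finite extension of `F`. Extension symbols are blocks of `F`-symbols, which multiplies
both block lengths by the degree.
-/

namespace SecureAgg

/-! ### Entropy under the uniform law -/

section UniformLaw

variable {Ω α β γ : Type*} [Fintype Ω]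

open Classical in
/-- The probability of `X = x` under the uniform law on `Ω`, as a real number. -/
noncomputable def freq (X : Ω → α) (x : α) : ℝ :=
  (Finset.univ.filter fun ω => X ω = x).card / (Fintype.card Ω : ℝ)

lemma freq_nonneg (X : Ω → α) (x : α) : 0 ≤ freq X x := by
  unfold freq; positivity

lemma freq_pos_iff (X : Ω → α) (x : α) : 0 < freq X x ↔ ∃ ω, X ω = x := by
  classical
  unfold freq
  constructor
  · intro h
    by_contra! hx
    rw [Finset.filter_false_of_mem (fun ω _ => hx ω)] at h
    simp at h
  · rintro ⟨ω, hω⟩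
    have : Nonempty Ω := ⟨ω⟩
    have h1 : 0 < (Finset.univ.filter fun ω => X ω = x).card :=
      Finset.card_pos.2 ⟨ω, by simp [hω]⟩
    have h2 : 0 < Fintype.card Ω := Fintype.card_pos
    positivity

open Classical in
lemma freq_eq_sum (X : Ω → α) (x : α) :
    freq X x = ∑ ω, if X ω = x then (Fintype.card Ω : ℝ)⁻¹ else 0 := by
  rw [← Finset.sum_filter, Finset.sum_const, nsmul_eq_mul, freq, div_eq_mul_inv]

lemma entropy_uniform [Nonempty Ω] [Fintype α] (X : Ω → α) :
    entropy (PMF.uniformOfFintype Ω) X = ∑ x, Real.negMulLog (freq X x) := by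
  classical
  unfold entropy
  refine Finset.sum_congr rfl fun x _ => ?_
  congr 1
  rw [PMF.map_apply, tsum_fintype, ENNReal.toReal_sum (by
    intro ω _; split_ifs <;> simp [PMF.uniformOfFintype_apply])]
  rw [freq_eq_sum]
  refine Finset.sum_congr rfl fun ω _ => ?_
  by_cases h : X ω = x
  · simp [h, PMF.uniformOfFintype_apply]
  · simp [h, Ne.symm h]

lemma sum_freq_pair [Fintype α] (X : Ω → α) (Y : Ω → β) (y : β) :
    ∑ x, freq (fun ω => (X ω, Y ω)) (x, y) = freq Y y := by
  classical
  simp_rw [freq_eq_sum]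
  rw [Finset.sum_comm]
  refine Finset.sum_congr rfl fun ω _ => ?_
  simp [Prod.mk.injEq, ite_and]

lemma sum_freq_triple [Fintype β] (X : Ω → α) (Y : Ω → β) (Z : Ω → γ) (x : α) (z : γ) :
    ∑ y, freq (fun ω => (X ω, Y ω, Z ω)) (x, y, z) = freq (fun ω => (X ω, Z ω)) (x, z) := by
  rw [← sum_freq_pair Y]
  refine Finset.sum_congr rfl fun y _ => ?_
  unfold freq
  congr 3
  ext ω
  simp only [Finset.mem_filter, Finset.mem_univ, true_and, Prod.mk.injEq]
  tauto

/-- The pointwise Gibbs inequality, with its equality case. -/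
lemma gibbs_pointwise {a b : ℝ} (ha : 0 ≤ a) (hb : 0 ≤ b) (hab : b = 0 → a = 0) :
    a - b ≤ a * (Real.log a - Real.log b) ∧
      (a * (Real.log a - Real.log b) = a - b → a = b) := by
  rcases ha.eq_or_lt with rfl | ha
  · refine ⟨by simpa using hb, fun h => ?_⟩
    linarith
  have hb : 0 < b := hb.lt_of_ne fun h => ha.ne' (hab h.symm)
  have hlog : Real.log a - Real.log b = - Real.log (b / a) := by
    rw [Real.log_div hb.ne' ha.ne']; ring
  have hmul : a * (b / a) = b := by field_simp
  constructor
  · have := Real.log_le_sub_one_of_pos (div_pos hb ha)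
    rw [hlog]
    nlinarith [mul_le_mul_of_nonneg_left this ha.le]
  · intro h
    by_contra hne
    have h1 : b / a ≠ 1 := fun h => hne (by rw [div_eq_one_iff_eq ha.ne'] at h; exact h.symm)
    have := Real.log_lt_sub_one_of_pos (div_pos hb ha) h1
    rw [hlog] at h
    nlinarith [mul_lt_mul_of_pos_left this ha]

/-- Conditional mutual information is the relative entropy between the joint law and
the law `p(x, z) p(y, z) / p(z)`; it vanishes exactly under conditional independence. -/
lemma condMutualInfo_uniform_eq_zero_iff [Nonempty Ω] [Fintype α] [Fintype β] [Fintype γ]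
    (X : Ω → α) (Y : Ω → β) (Z : Ω → γ) :
    condMutualInfo (PMF.uniformOfFintype Ω) X Y Z = 0 ↔
      ∀ x y z, freq (fun ω => (X ω, Y ω, Z ω)) (x, y, z) * freq Z z =
        freq (fun ω => (X ω, Z ω)) (x, z) * freq (fun ω => (Y ω, Z ω)) (y, z) := by
  set p : α × β × γ → ℝ := freq (fun ω => (X ω, Y ω, Z ω)) with hp
  set pXZ := freq (fun ω => (X ω, Z ω)) with hpXZ
  set pYZ := freq (fun ω => (Y ω, Z ω)) with hpYZ
  set pZ := freq Z with hpZ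
  have mXZ : ∀ x z, ∑ y, p (x, y, z) = pXZ (x, z) := sum_freq_triple X Y Z
  have mYZ : ∀ y z, ∑ x, p (x, y, z) = pYZ (y, z) := fun y z =>
    sum_freq_pair X (fun ω => (Y ω, Z ω)) (y, z)
  have mX : ∀ z, ∑ x, pXZ (x, z) = pZ z := sum_freq_pair X Z
  have mY : ∀ z, ∑ y, pYZ (y, z) = pZ z := sum_freq_pair Y Z
  have p0 : ∀ t, 0 ≤ p t := freq_nonneg _
  have pXZ0 : ∀ t, 0 ≤ pXZ t := freq_nonneg _
  have pYZ0 : ∀ t, 0 ≤ pYZ t := freq_nonneg _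
  have pZ0 : ∀ t, 0 ≤ pZ t := freq_nonneg _
  have zXZ : ∀ x y z, pXZ (x, z) = 0 → p (x, y, z) = 0 := fun x y z h =>
    (Finset.sum_eq_zero_iff_of_nonneg (fun y _ => p0 _)).1 ((mXZ x z).trans h) y
      (Finset.mem_univ _)
  have zYZ : ∀ x y z, pYZ (y, z) = 0 → p (x, y, z) = 0 := fun x y z h =>
    (Finset.sum_eq_zero_iff_of_nonneg (fun y _ => p0 _)).1 ((mYZ y z).trans h) x
      (Finset.mem_univ _)
  have zZ : ∀ x z, pZ z = 0 → pXZ (x, z) = 0 := fun x z h =>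
    (Finset.sum_eq_zero_iff_of_nonneg (fun y _ => pXZ0 _)).1 ((mX z).trans h) x
      (Finset.mem_univ _)
  set r : α × β × γ → ℝ := fun t => pXZ (t.1, t.2.2) * pYZ (t.2.1, t.2.2) / pZ t.2.2 with hr
  have r0 : ∀ t, 0 ≤ r t := fun t => div_nonneg (mul_nonneg (pXZ0 _) (pYZ0 _)) (pZ0 _)
  have hrz : ∀ t, r t = 0 → p t = 0 := by
    rintro ⟨x, y, z⟩ h
    simp only [hr, div_eq_zero_iff, mul_eq_zero] at h
    rcases h with (h | h) | h
    · exact zXZ _ _ _ h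
    · exact zYZ _ _ _ h
    · exact zXZ _ _ _ (zZ _ _ h)
  have sum_r : ∑ t, r t = ∑ t, p t := by
    have h1 : ∑ t, r t = ∑ z, pZ z := by
      simp_rw [Fintype.sum_prod_type]
      rw [Finset.sum_congr rfl fun x _ => Finset.sum_comm, Finset.sum_comm]
      refine Finset.sum_congr rfl fun z _ => ?_
      simp only [hr, ← Finset.sum_div, ← Finset.mul_sum, ← Finset.sum_mul, mX, mY]
      by_cases h : pZ z = 0
      · simp [h]
      · field_simp
    have h2 : ∑ t, p t = ∑ z, pZ z := by
      simp_rw [Fintype.sum_prod_type]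
      rw [Finset.sum_congr rfl fun x _ => Finset.sum_comm, Finset.sum_comm]
      refine Finset.sum_congr rfl fun z _ => ?_
      simp only [mXZ, mX]
    rw [h1, h2]
  have key : condMutualInfo (PMF.uniformOfFintype Ω) X Y Z =
      ∑ t, p t * (Real.log (p t) - Real.log (r t)) := by
    simp only [condMutualInfo, condEntropy, entropy_uniform, ← hp, ← hpXZ, ← hpYZ, ← hpZ]
    have e1 : ∑ t, Real.negMulLog (pXZ t) =
        ∑ t : α × β × γ, - (p t * Real.log (pXZ (t.1, t.2.2))) := by
      simp_rw [Fintype.sum_prod_type]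
      refine Finset.sum_congr rfl fun x _ => ?_
      rw [Finset.sum_comm]
      refine Finset.sum_congr rfl fun z _ => ?_
      rw [Finset.sum_neg_distrib, ← Finset.sum_mul, mXZ, Real.negMulLog, neg_mul]
    have e2 : ∑ t, Real.negMulLog (pYZ t) = ∑ t : α × β × γ, - (p t * Real.log (pYZ t.2)) := by
      rw [Fintype.sum_prod_type (f := fun t : α × β × γ => - (p t * Real.log (pYZ t.2))),
        Finset.sum_comm]
      refine Finset.sum_congr rfl fun t _ => ?_
      simp only [Finset.sum_neg_distrib, ← Finset.sum_mul]
      rw [mYZ, Real.negMulLog, neg_mul]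
    have e3 : ∑ t, Real.negMulLog (pZ t) = ∑ t : α × β × γ, - (p t * Real.log (pZ t.2.2)) := by
      simp_rw [Fintype.sum_prod_type]
      rw [Finset.sum_congr rfl fun x _ => Finset.sum_comm, Finset.sum_comm]
      refine Finset.sum_congr rfl fun z _ => ?_
      simp only [Finset.sum_neg_distrib, ← Finset.sum_mul, mXZ, mX, Real.negMulLog, neg_mul]
    rw [e1, e2, e3, ← Finset.sum_sub_distrib, ← Finset.sum_sub_distrib, ← Finset.sum_sub_distrib]
    refine Finset.sum_congr rfl fun t _ => ?_
    by_cases h : p t = 0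
    · simp [h]
    have h1 : pXZ (t.1, t.2.2) ≠ 0 := fun h' => h (zXZ _ _ _ h')
    have h2 : pYZ (t.2.1, t.2.2) ≠ 0 := fun h' => h (zYZ _ _ _ h')
    have h3 : pZ t.2.2 ≠ 0 := fun h' => h1 (zZ _ _ h')
    simp only [hr]
    rw [Real.log_div (mul_ne_zero h1 h2) h3, Real.log_mul h1 h2, Real.negMulLog]
    ring
  have gibbs := fun t => gibbs_pointwise (p0 t) (r0 t) (hrz t)
  have key0 : condMutualInfo (PMF.uniformOfFintype Ω) X Y Z =
      ∑ t, (p t * (Real.log (p t) - Real.log (r t)) - (p t - r t)) := by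
    rw [Finset.sum_sub_distrib, Finset.sum_sub_distrib, sum_r, sub_self, sub_zero, key]
  rw [key0, Finset.sum_eq_zero_iff_of_nonneg (fun t _ => sub_nonneg.2 (gibbs t).1)]
  constructor
  · intro h x y z
    have := (gibbs (x, y, z)).2 (sub_eq_zero.1 (h (x, y, z) (Finset.mem_univ _)))
    rw [this]
    by_cases hz : pZ z = 0
    · simp [hz, zZ x z hz]
    · simp only [hr]; field_simp
  · rintro h ⟨x, y, z⟩ -
    have : p (x, y, z) = r (x, y, z) := by
      by_cases hz : pZ z = 0
      · simp [hr, hz, zXZ x y z (zZ x z hz)]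
      · simp only [hr]; rw [eq_div_iff hz, h]
    simp [this]

lemma condEntropy_uniform_eq_zero_iff [Nonempty Ω] [Fintype α] [Fintype β]
    (X : Ω → α) (Y : Ω → β) :
    condEntropy (PMF.uniformOfFintype Ω) X Y = 0 ↔ ∀ ω ω', Y ω = Y ω' → X ω = X ω' := by
  set p : α × β → ℝ := freq (fun ω => (X ω, Y ω)) with hp
  set pY := freq Y with hpY
  have m : ∀ y, ∑ x, p (x, y) = pY y := sum_freq_pair X Y
  have p0 : ∀ t, 0 ≤ p t := freq_nonneg _
  have le : ∀ t : α × β, p t ≤ pY t.2 := fun t => by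
    rw [← m]
    exact Finset.single_le_sum (f := fun x => p (x, t.2)) (fun _ _ => p0 _) (Finset.mem_univ t.1)
  have key : condEntropy (PMF.uniformOfFintype Ω) X Y =
      ∑ t : α × β, p t * (Real.log (pY t.2) - Real.log (p t)) := by
    simp only [condEntropy, entropy_uniform, ← hp, ← hpY]
    have e : ∑ y, Real.negMulLog (pY y) = ∑ t : α × β, - (p t * Real.log (pY t.2)) := by
      rw [Fintype.sum_prod_type, Finset.sum_comm]
      refine Finset.sum_congr rfl fun y _ => ?_
      simp only [Finset.sum_neg_distrib, ← Finset.sum_mul]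
      rw [m, Real.negMulLog, neg_mul]
    rw [e, ← Finset.sum_sub_distrib]
    refine Finset.sum_congr rfl fun t _ => ?_
    rw [Real.negMulLog]; ring
  have nn : ∀ t : α × β, 0 ≤ p t * (Real.log (pY t.2) - Real.log (p t)) := fun t => by
    rcases (p0 t).eq_or_lt with h | h
    · simp [← h]
    · exact mul_nonneg h.le (sub_nonneg.2 (Real.log_le_log h (le t)))
  rw [key, Finset.sum_eq_zero_iff_of_nonneg (fun t _ => nn t)]
  constructor
  · intro h ω ω' hY
    by_contra hne
    have h1 : 0 < p (X ω, Y ω) := (freq_pos_iff _ _).2 ⟨ω, rfl⟩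
    have h2 : 0 < p (X ω', Y ω) := (freq_pos_iff _ _).2 ⟨ω', by simp [hY]⟩
    have h3 : p (X ω, Y ω) + p (X ω', Y ω) ≤ pY (Y ω) := by
      rw [← m]
      exact Finset.add_le_sum (f := fun x => p (x, Y ω)) (fun _ _ => p0 _)
        (Finset.mem_univ _) (Finset.mem_univ _) hne
    rcases mul_eq_zero.1 (h (X ω, Y ω) (Finset.mem_univ _)) with h4 | h4
    · exact h1.ne' h4
    · have := Real.log_lt_log h1 (show p (X ω, Y ω) < pY (Y ω) by linarith)
      simp only at h4
      linarith
  · rintro h ⟨x, y⟩ -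
    rcases (p0 (x, y)).eq_or_lt with h0 | h0
    · simp [← h0]
    obtain ⟨ω, hω⟩ := (freq_pos_iff _ _).1 h0
    simp only [Prod.mk.injEq] at hω
    have : p (x, y) = pY y := by
      rw [← m, Finset.sum_eq_single x]
      · intro x' _ hx'
        by_contra h1
        obtain ⟨ω', hω'⟩ := (freq_pos_iff _ _).1 ((p0 (x', y)).lt_of_ne (Ne.symm h1))
        simp only [Prod.mk.injEq] at hω'
        exact hx' (by rw [← hω'.1, ← hω.1]; exact h _ _ (hω'.2.trans hω.2.symm))
      · simp
    simp [this]

/-- Vanishing conditional mutual information lets two outcomes with the same `Z` be spliced: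
some outcome has the `X` of the one and the `Y` of the other. -/
lemma exists_splice_of_condMutualInfo_eq_zero [Nonempty Ω] [Fintype α] [Fintype β] [Fintype γ]
    {X : Ω → α} {Y : Ω → β} {Z : Ω → γ}
    (h : condMutualInfo (PMF.uniformOfFintype Ω) X Y Z = 0) {ω₁ ω₂ : Ω} (hZ : Z ω₁ = Z ω₂) :
    ∃ ω, X ω = X ω₁ ∧ Y ω = Y ω₂ ∧ Z ω = Z ω₁ := by
  have h1 := (condMutualInfo_uniform_eq_zero_iff X Y Z).1 h (X ω₁) (Y ω₂) (Z ω₁)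
  have hx : 0 < freq (fun ω => (X ω, Z ω)) (X ω₁, Z ω₁) := (freq_pos_iff _ _).2 ⟨ω₁, rfl⟩
  have hy : 0 < freq (fun ω => (Y ω, Z ω)) (Y ω₂, Z ω₁) :=
    (freq_pos_iff _ _).2 ⟨ω₂, by simp [hZ]⟩
  have h2 := mul_pos hx hy
  rw [← h1] at h2
  obtain ⟨ω, hω⟩ := (freq_pos_iff _ _).1 (pos_of_mul_pos_left h2 (freq_nonneg _ _))
  simp only [Prod.mk.injEq] at hω
  exact ⟨ω, hω⟩

/-- For additive maps on a finite group, conditional independence only has to be checked on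
the kernel of `Z`: the values of `X` there must already be attained where `Y` vanishes too. -/
lemma condMutualInfo_eq_zero_of_addMonoidHom [AddCommGroup Ω] [AddCommGroup α] [AddCommGroup β]
    [AddCommGroup γ] [Fintype α] [Fintype β] [Fintype γ] (X : Ω →+ α) (Y : Ω →+ β) (Z : Ω →+ γ)
    (h : ∀ ω, Z ω = 0 → ∃ ω', Z ω' = 0 ∧ Y ω' = 0 ∧ X ω' = X ω) :
    condMutualInfo (PMF.uniformOfFintype Ω) X Y Z = 0 := by
  classical
  rw [condMutualInfo_uniform_eq_zero_iff]
  intro x y z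
  -- A correction `s a` in `ker Z ∩ ker Y` with `X`-value `a`, depending on `a` only.
  have hs : ∀ a : α, ∃ s : Ω, (∃ ω, Z ω = 0 ∧ X ω = a) → Z s = 0 ∧ Y s = 0 ∧ X s = a := by
    intro a
    by_cases ha : ∃ ω, Z ω = 0 ∧ X ω = a
    · obtain ⟨ω, hω, rfl⟩ := ha
      obtain ⟨s, hs⟩ := h ω hω
      exact ⟨s, fun _ => hs⟩
    · exact ⟨0, fun h => absurd h ha⟩
  choose s hs using hs
  -- Adding the correction to one outcome and subtracting it from the other exchanges the
  -- `X`-values of the two, which is an involution.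
  let φ : Ω × Ω → Ω × Ω := fun t => (t.2 - s (X t.2 - X t.1), t.1 + s (X t.2 - X t.1))
  have hφ : ∀ a b : Ω, Z a = z → Z b = z →
      (X (φ (a, b)).1 = X a ∧ Y (φ (a, b)).1 = Y b ∧ Z (φ (a, b)).1 = z) ∧
      (X (φ (a, b)).2 = X b ∧ Y (φ (a, b)).2 = Y a ∧ Z (φ (a, b)).2 = z) ∧
      φ (φ (a, b)) = (a, b) := by
    intro a b ha hb
    obtain ⟨h1, h2, h3⟩ := hs (X b - X a) ⟨b - a, by simp [ha, hb], by simp⟩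
    have h4 : X (a + s (X b - X a)) - X (b - s (X b - X a)) = X b - X a := by
      rw [map_add, map_sub, h3]; abel
    refine ⟨by simp [φ, h1, h2, h3, hb],
      by simp [φ, h1, h2, h3, ha], ?_⟩
    simp only [φ]
    rw [h4, add_sub_cancel_right, sub_add_cancel]
  unfold freq
  rw [div_mul_div_comm, div_mul_div_comm]
  congr 1
  norm_cast
  rw [← Finset.card_product, ← Finset.card_product]
  refine Finset.card_bij' (fun t _ => φ t) (fun t _ => φ t) ?_ ?_ ?_ ?_ <;>
    rintro ⟨a, b⟩ hab <;>
    simp only [Finset.mem_product, Finset.mem_filter, Finset.mem_univ, true_and,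
      Prod.mk.injEq] at hab ⊢
  · obtain ⟨h1, h2, -⟩ := hφ a b hab.1.2.2 hab.2
    exact ⟨⟨h1.1.trans hab.1.1, h1.2.2⟩, h2.2.1.trans hab.1.2.1, h2.2.2⟩
  · obtain ⟨h1, h2, -⟩ := hφ a b hab.1.2 hab.2.2
    exact ⟨⟨h1.1.trans hab.1.1, h1.2.1.trans hab.2.1, h1.2.2⟩, h2.2.2⟩
  · exact (hφ a b hab.1.2.2 hab.2).2.2
  · exact (hφ a b hab.1.2 hab.2.2).2.2

end UniformLaw

/-! ### Lower bounds on the rates -/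

section Converse

lemma inputSum_single {F : Type*} [Field F] {K G L LS : ℕ} (i : Fin K) (w : Fin L → F)
    (s : UserGroup K G → Fin LS → F) :
    inputSum ((Pi.single i w, s) : Sample F K G L LS) = w := by
  simp [inputSum, input]

variable {F : Type*} [Field F] [Fintype F] {K G L LX LS T : ℕ} {σ : Scheme F K G L LX LS}

lemma Scheme.Recovery.inputSum_eq (h : σ.Recovery) (k : Fin K) {ω ω' : Sample F K G L LS}
    (hX : ∀ i, i ≠ k → σ.message i ω = σ.message i ω') (hW : input k ω = input k ω')
    (hZ : indivKey k ω = indivKey k ω') : inputSum ω = inputSum ω' :=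
  (condEntropy_uniform_eq_zero_iff _ _).1 (h k) ω ω' <| by
    simp only [Prod.mk.injEq]
    exact ⟨funext fun i => hX i.1 i.2, hW, hZ⟩

/-- The possibilistic content of security: whatever the other users received could equally have
arisen from any inputs compatible with the sum and with what the colluders hold. -/
lemma Scheme.Security.exists_splice (h : σ.Security T) {k : Fin K} {𝒯 : Finset (Fin K)}
    (hk : k ∉ 𝒯) (hT : 𝒯.card ≤ T) {ω₁ ω₂ : Sample F K G L LS}
    (hsum : inputSum ω₁ = inputSum ω₂) (hW : ∀ i, i = k ∨ i ∈ 𝒯 → input i ω₁ = input i ω₂)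
    (hZ : ∀ i, i = k ∨ i ∈ 𝒯 → indivKey i ω₁ = indivKey i ω₂) :
    ∃ ω : Sample F K G L LS, (∀ i, i ≠ k → σ.message i ω = σ.message i ω₁) ∧
      (∀ i, input i ω = input i ω₂) ∧
      ∀ i, i = k ∨ i ∈ 𝒯 → indivKey i ω = indivKey i ω₁ := by
  obtain ⟨ω, h1, h2, h3⟩ := exists_splice_of_condMutualInfo_eq_zero (h k 𝒯 hk hT)
    (ω₁ := ω₁) (ω₂ := ω₂) (by
      simp only [Prod.mk.injEq]
      exact ⟨hsum, hW k (.inl rfl), hZ k (.inl rfl), funext fun i =>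
        Prod.ext (hW i.1 (.inr i.2)) (hZ i.1 (.inr i.2))⟩)
  simp only [Prod.mk.injEq] at h3
  refine ⟨ω, fun i hi => congrFun h1 ⟨i, hi⟩, fun i => ?_, ?_⟩
  · by_cases hi : i = k
    · subst hi
      exact h3.2.1.trans (hW i (.inl rfl))
    · exact congrFun h2 ⟨i, hi⟩
  · rintro i (rfl | hi)
    · exact h3.2.2.1
    · exact congrArg Prod.snd (congrFun h3.2.2.2 ⟨i, hi⟩)

/-- Recovery forces the message of user `i` to determine its input, even if the keys that no other
user holds are changed: no other message and no other key would tell the difference. -/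
lemma Scheme.Recovery.eq_of_encode_eq (h : σ.Recovery) {k i : Fin K} (hik : i ≠ k)
    {w w' : Fin L → F} {s s' : UserGroup K G → Fin LS → F}
    (hs : ∀ j, j ≠ i → ∀ 𝒢 : UserGroup K G, j ∈ 𝒢.1 → s 𝒢 = s' 𝒢)
    (he : σ.encode i w (fun 𝒢 => s 𝒢.1) = σ.encode i w' (fun 𝒢 => s' 𝒢.1)) : w = w' := by
  rw [← inputSum_single i w s, ← inputSum_single i w' s']
  have hZ : ∀ j, j ≠ i → indivKey (L := L) j (Pi.single i w, s) =
      indivKey (L := L) j (Pi.single i w', s') :=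
    fun j hj => funext fun 𝒢 => hs j hj 𝒢.1 𝒢.2
  have hW : ∀ j, j ≠ i → input (G := G) (LS := LS) j (Pi.single i w, s) =
      input j (Pi.single i w', s') := fun j hj => by
    simp [input, Pi.single_eq_of_ne hj]
  refine h.inputSum_eq k (fun j _ => ?_) (hW k hik.symm) (hZ k hik.symm)
  by_cases hj : j = i
  · subst hj
    have e : ∀ v : Fin L → F, ∀ t : UserGroup K G → Fin LS → F,
        σ.message j (Pi.single j v, t) = σ.encode j v (fun 𝒢 => t 𝒢.1) := fun v t => by
      simp only [Scheme.message, input, Pi.single_eq_same]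
      rfl
    rw [e, e, he]
  · rw [Scheme.message, Scheme.message, hZ j hj, hW j hj]

lemma Scheme.Recovery.encode_injective (h : σ.Recovery) {k i : Fin K} (hik : i ≠ k)
    (s : UserGroup K G → Fin LS → F) :
    Function.Injective fun w => σ.encode i w (fun 𝒢 => s 𝒢.1) :=
  fun _ _ he => h.eq_of_encode_eq hik (fun _ _ _ _ => rfl) he

lemma Scheme.Recovery.le_messageLength (h : σ.Recovery) (hK : 2 ≤ K) : L ≤ LX := by
  have hne : (⟨1, by omega⟩ : Fin K) ≠ ⟨0, by omega⟩ := by simp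
  have hcard := Fintype.card_le_of_injective _ (h.encode_injective hne 0)
  simp only [Fintype.card_fun, Fintype.card_fin] at hcard
  exact (Nat.pow_le_pow_iff_right Fintype.one_lt_card).1 hcard

/-- The number of groups contained in a set `U` of users. -/
lemma card_groups_subset (U : Finset (Fin K)) :
    Fintype.card {𝒢 : UserGroup K G // 𝒢.1 ⊆ U} = U.card.choose G := by
  rw [← Finset.card_powersetCard, ← Fintype.card_coe]
  refine Fintype.card_congr
    ⟨fun 𝒢 => ⟨𝒢.1.1, Finset.mem_powersetCard.2 ⟨𝒢.2, 𝒢.1.2⟩⟩,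
      fun 𝒢 => ⟨⟨𝒢.1, (Finset.mem_powersetCard.1 𝒢.2).2⟩, (Finset.mem_powersetCard.1 𝒢.2).1⟩,
      fun _ => rfl, fun _ => rfl⟩

/-- The key converse. Let `U` be the users outside a maximal coalition. The messages of `U` can
take as many values as there are zero-sum inputs on `U`, and by security all of these values are
already attained for zero inputs, hence by varying only the keys shared within `U`. -/
lemma Scheme.Security.le_keyLength (hS : σ.Security T) (hR : σ.Recovery) (hT : T + 2 ≤ K) :
    (K - T - 2) * L ≤ (K - T - 1).choose G * LS := by
  classical
  obtain ⟨k, p, hkp⟩ : ∃ k p : Fin K, k ≠ p :=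
    ⟨⟨0, by omega⟩, ⟨1, by omega⟩, by simp⟩
  obtain ⟨𝒯, h𝒯, hcard⟩ := Finset.exists_subset_card_eq
    (s := (Finset.univ \ {k, p} : Finset (Fin K))) (n := T) (by
      rw [Finset.card_sdiff_of_subset (Finset.subset_univ _), Finset.card_pair hkp]
      simp; omega)
  have hk𝒯 : k ∉ 𝒯 := fun h => by simpa using h𝒯 h
  have hp𝒯 : p ∉ 𝒯 := fun h => by simpa using h𝒯 h
  set U : Finset (Fin K) := (insert k 𝒯)ᶜ with hU
  have hUcard : U.card = K - T - 1 := by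
    rw [hU, Finset.card_compl, Finset.card_insert_of_notMem hk𝒯, hcard, Fintype.card_fin]
    omega
  have hpU : p ∈ U := by simp [hU, hp𝒯, hkp.symm]
  have hkU : k ∉ U := by simp [hU]
  have hcompl : ∀ i, i ∉ U ↔ i = k ∨ i ∈ 𝒯 := fun i => by
    simp only [hU, Finset.mem_compl, not_not, Finset.mem_insert]
  -- The zero-sum inputs supported on `U`, parametrized by their values away from `p`.
  let W : ({i // i ∈ U.erase p} → Fin L → F) → Fin K → Fin L → F := fun t i =>
    if h : i ∈ U.erase p then t ⟨i, h⟩ else if i = p then - ∑ j, t j else 0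
  have hWU : ∀ t i, i ∉ U → W t i = 0 := fun t i hi => by
    have h1 : i ∉ U.erase p := fun h => hi (Finset.mem_of_mem_erase h)
    have h2 : i ≠ p := fun h => hi (h ▸ hpU)
    simp only [W, dif_neg h1, if_neg h2]
  have hWsum : ∀ t, ∑ i, W t i = 0 := fun t => by
    rw [← Finset.sum_subset (Finset.subset_univ U) (fun i _ hi => hWU t i hi),
      ← Finset.add_sum_erase U _ hpU]
    have h1 : W t p = - ∑ j, t j := by simp [W]
    have h2 : ∑ i ∈ U.erase p, W t i = ∑ j, t j := by
      rw [← Finset.sum_attach]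
      exact Finset.sum_congr rfl fun i _ => by simp only [W, dif_pos i.2]
    rw [h1, h2, neg_add_cancel]
  have key : ∀ t, ∃ s : UserGroup K G → Fin LS → F,
      (∀ 𝒢 : UserGroup K G, ¬ 𝒢.1 ⊆ U → s 𝒢 = 0) ∧
      ∀ i, i ≠ k → σ.encode i 0 (fun 𝒢 => s 𝒢.1) = σ.encode i (W t i) 0 := by
    intro t
    obtain ⟨ω, h1, h2, h3⟩ := hS.exists_splice hk𝒯 hcard.le
      (ω₁ := (W t, 0)) (ω₂ := (0, 0)) (by simp [inputSum, input, hWsum])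
      (fun i hi => hWU t i ((hcompl i).2 hi)) (fun _ _ => rfl)
    refine ⟨ω.2, fun 𝒢 h𝒢 => ?_, fun i hi => ?_⟩
    · obtain ⟨i, hi, hiU⟩ := Finset.not_subset.1 h𝒢
      exact congrFun (h3 i ((hcompl i).1 hiU)) ⟨𝒢, hi⟩
    · have := h1 i hi
      rw [Scheme.message, Scheme.message, h2 i] at this
      exact this
  choose s hs0 hs using key
  have hinj : Function.Injective
      fun t (𝒢 : {𝒢 : UserGroup K G // 𝒢.1 ⊆ U}) => s t 𝒢.1 := by
    intro t t' htt
    have hst : s t = s t' := funext fun 𝒢 => by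
      by_cases h : 𝒢.1 ⊆ U
      · exact congrFun htt ⟨𝒢, h⟩
      · rw [hs0 t 𝒢 h, hs0 t' 𝒢 h]
    funext i
    have hik : i.1 ≠ k := fun h => hkU (h ▸ Finset.mem_of_mem_erase i.2)
    have he := hs t i.1 hik
    rw [hst, hs t' i.1 hik] at he
    have := hR.encode_injective hik 0 he.symm
    simpa only [W, dif_pos i.2] using this
  have hle := Fintype.card_le_of_injective _ hinj
  simp only [Fintype.card_fun, Fintype.card_fin, card_groups_subset, Fintype.card_coe,
    Finset.card_erase_of_mem hpU, hUcard, ← pow_mul] at hle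
  rw [Nat.pow_le_pow_iff_right Fintype.one_lt_card] at hle
  rw [mul_comm, mul_comm _ LS]
  exact hle

/-- With private keys only, recovery makes each message determine its input, which security
forbids. -/
lemma Scheme.Security.not_recovery_of_private_keys {σ : Scheme F K 1 L LX LS}
    (hS : σ.Security T) (hK : 3 ≤ K) (hL : 0 < L) : ¬ σ.Recovery := by
  intro hR
  let k : Fin K := ⟨0, by omega⟩
  let i : Fin K := ⟨1, by omega⟩
  let j : Fin K := ⟨2, by omega⟩
  have hik : i ≠ k := by simp [i, k]
  have hjk : j ≠ k := by simp [j, k]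
  have hij : i ≠ j := by simp [i, j]
  let a : Fin L → F := fun _ => 1
  have ha : a ≠ 0 := fun h => one_ne_zero (congrFun h ⟨0, hL⟩)
  let w : Fin K → Fin L → F := Pi.single i a - Pi.single j a
  obtain ⟨ω, h1, h2, -⟩ := hS.exists_splice (k := k) (𝒯 := ∅) (by simp) (by simp)
    (ω₁ := (w, 0)) (ω₂ := (0, 0)) (by simp [inputSum, input, w])
    (fun l hl => by
      have : l = k := by simpa using hl
      subst this
      simp [input, w, Pi.single_eq_of_ne hik.symm, Pi.single_eq_of_ne hjk.symm])
    (fun _ _ => rfl)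
  have h3 := h1 i hik
  rw [Scheme.message, Scheme.message, h2 i] at h3
  -- Only the key of the group `{i}` matters to user `i`.
  let s : UserGroup K 1 → Fin LS → F := fun 𝒢 => if i ∈ 𝒢.1 then ω.2 𝒢 else 0
  refine ha (hR.eq_of_encode_eq (w := a) (w' := 0) (s := 0) (s' := s) hik ?_ ?_)
  · intro l hl 𝒢 hl𝒢
    have : i ∉ 𝒢.1 := fun hi => hl (Finset.card_le_one.1 𝒢.2.le l hl𝒢 i hi)
    simp [s, this]
  · have e1 : input i ((w, 0) : Sample F K 1 L LS) = a := by
      simp [input, w, Pi.single_eq_of_ne hij]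
    have e2 : (fun 𝒢 : {𝒢 : UserGroup K 1 // i ∈ 𝒢.1} => s 𝒢.1) = indivKey i ω :=
      funext fun 𝒢 => if_pos 𝒢.2
    rw [e1] at h3
    rw [e2]
    exact h3.symm

end Converse

/-! ### Keys spanning the zero-sum values -/

section KeyMaps

variable {M N : Type*} [AddCommGroup M] [AddCommGroup N] {K G : ℕ}

/-- The keys shared within `U` span all zero-sum values on `U`: when user `i` applies the maps
`B i 𝒢` to the keys and adds up the results, every zero-sum family supported on `U` arises from
some choice of the keys of the groups inside `U`. -/
def KeysSpan (B : Fin K → UserGroup K G → M →+ N) (U : Finset (Fin K)) : Prop :=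
  ∀ v : Fin K → N, (∀ i, i ∉ U → v i = 0) → ∑ i, v i = 0 →
    ∃ s : UserGroup K G → M, (∀ 𝒢 : UserGroup K G, ¬ 𝒢.1 ⊆ U → s 𝒢 = 0) ∧
      ∀ i, ∑ 𝒢, B i 𝒢 (s 𝒢) = v i

/-- Zero-sum families on a large set are sums of zero-sum families supported on pairs, and every
pair lies in a subset of size `u`. -/
lemma KeysSpan.of_card_le {B : Fin K → UserGroup K G → M →+ N} {u : ℕ} (hu : 2 ≤ u)
    (h : ∀ U : Finset (Fin K), U.card = u → KeysSpan B U) {U : Finset (Fin K)}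
    (hU : u ≤ U.card) : KeysSpan B U := by
  classical
  intro v hv hsum
  obtain ⟨p, hp⟩ : U.Nonempty := Finset.card_pos.1 (by omega)
  have key : ∀ i ∈ U, ∃ s : UserGroup K G → M,
      (∀ 𝒢 : UserGroup K G, ¬ 𝒢.1 ⊆ U → s 𝒢 = 0) ∧
      ∀ l, ∑ 𝒢, B l 𝒢 (s 𝒢) = (Pi.single i (v i) - Pi.single p (v i) : Fin K → N) l := by
    intro i hi
    have hip : ({i, p} : Finset (Fin K)) ⊆ U := by
      simp [Finset.insert_subset_iff, hi, hp]
    obtain ⟨U', h1, h2, h3⟩ := Finset.exists_subsuperset_card_eq hip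
      (Finset.card_le_two.trans hu) hU
    have hi' : i ∈ U' := h1 (by simp)
    have hp' : p ∈ U' := h1 (by simp)
    obtain ⟨s, hs0, hs⟩ := h U' h3 (Pi.single i (v i) - Pi.single p (v i))
      (fun l hl => by
        have e1 : l ≠ i := fun h => hl (h ▸ hi')
        have e2 : l ≠ p := fun h => hl (h ▸ hp')
        simp [Pi.single_eq_of_ne e1, Pi.single_eq_of_ne e2])
      (by simp)
    exact ⟨s, fun 𝒢 h𝒢 => hs0 𝒢 fun h => h𝒢 (h.trans h2), hs⟩
  choose! s hs0 hs using key
  refine ⟨fun 𝒢 => ∑ i ∈ U, s i 𝒢, fun 𝒢 h𝒢 => Finset.sum_eq_zero fun i hi => hs0 i hi 𝒢 h𝒢,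
    fun l => ?_⟩
  simp only [map_sum]
  rw [Finset.sum_comm, Finset.sum_congr rfl fun i hi => hs i hi l]
  have hsumU : ∑ i ∈ U, v i = 0 := by
    rw [Finset.sum_subset (Finset.subset_univ U) fun i _ hi => hv i hi, hsum]
  simp only [Pi.sub_apply, Finset.sum_sub_distrib]
  have e1 : ∑ i ∈ U, (Pi.single p (v i) : Fin K → N) l = 0 := by
    by_cases hl : l = p
    · subst hl; simpa using hsumU
    · simp [Pi.single_eq_of_ne hl]
  rw [e1, sub_zero]
  by_cases hl : l ∈ U
  · rw [Finset.sum_eq_single l (fun i _ hi => Pi.single_eq_of_ne hi.symm _)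
      (fun h => absurd hl h), Pi.single_eq_same]
  · rw [hv l hl]
    exact Finset.sum_eq_zero fun i hi => Pi.single_eq_of_ne (by rintro rfl; exact hl hi) _

end KeyMaps

/-! ### Schemes that mask the inputs by linear images of the keys -/

section LinearScheme

variable {F : Type*} [Field F] {K G L LS : ℕ}

/-- The scheme in which every user masks its input by additive images of its keys. -/
def Scheme.masking (B : Fin K → UserGroup K G → (Fin LS → F) →+ (Fin L → F)) :
    Scheme F K G L L LS where
  encode k w z := w + ∑ 𝒢 : {𝒢 : UserGroup K G // k ∈ 𝒢.1}, B k 𝒢.1 (z 𝒢)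

variable {B : Fin K → UserGroup K G → (Fin LS → F) →+ (Fin L → F)}

lemma Scheme.masking_message (hB : ∀ k 𝒢, k ∉ 𝒢.1 → B k 𝒢 = 0) (k : Fin K)
    (ω : Sample F K G L LS) :
    (Scheme.masking B).message k ω = ω.1 k + ∑ 𝒢, B k 𝒢 (ω.2 𝒢) := by
  classical
  simp only [Scheme.message, Scheme.masking, input, indivKey]
  congr 1
  rw [← Finset.sum_subtype (Finset.univ.filter fun 𝒢 : UserGroup K G => k ∈ 𝒢.1) (by simp)
    fun 𝒢 => B k 𝒢 (ω.2 𝒢), Finset.sum_filter_of_ne]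
  intro 𝒢 _ h
  by_contra hk
  exact h (by rw [hB k 𝒢 hk, AddMonoidHom.zero_apply])

lemma Scheme.masking_recovery [Fintype F] (hB : ∀ k 𝒢, k ∉ 𝒢.1 → B k 𝒢 = 0)
    (hsum : ∀ 𝒢 x, ∑ k, B k 𝒢 x = 0) : (Scheme.masking B).Recovery := by
  have hmsg : ∀ ω : Sample F K G L LS, ∑ k, (Scheme.masking B).message k ω = inputSum ω := by
    intro ω
    simp only [Scheme.masking_message hB, Finset.sum_add_distrib]
    rw [Finset.sum_comm]
    simp [hsum, inputSum, input]
  intro k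
  refine (condEntropy_uniform_eq_zero_iff _ _).2 fun ω ω' h => ?_
  simp only [Prod.mk.injEq] at h
  rw [← hmsg, ← hmsg]
  refine Finset.sum_congr rfl fun i _ => ?_
  by_cases hi : i = k
  · subst hi
    rw [Scheme.message, Scheme.message, h.2.1, h.2.2]
  · exact congrFun h.1 ⟨i, hi⟩

/-- What the other users send is a zero-sum family once the sum and the coalition's own data are
zero, so it can be produced by keys alone; by additivity this is all that security needs. -/
lemma Scheme.masking_security [Fintype F] {T : ℕ} (hB : ∀ k 𝒢, k ∉ 𝒢.1 → B k 𝒢 = 0)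
    (hsum : ∀ 𝒢 x, ∑ k, B k 𝒢 x = 0)
    (hspan : ∀ U : Finset (Fin K), K - T - 1 ≤ U.card → KeysSpan B U) :
    (Scheme.masking B).Security T := by
  classical
  intro k 𝒯 hk h𝒯
  let X : Sample F K G L LS →+ (∀ _ : {i : Fin K // i ≠ k}, (Fin L → F)) :=
    { toFun := (Scheme.masking B).received k
      map_zero' := funext fun i => by simp [Scheme.received, Scheme.masking_message hB]
      map_add' := fun ω ω' => funext fun i => by
        simp only [Scheme.received, Scheme.masking_message hB, Prod.fst_add, Prod.snd_add,
          Pi.add_apply, map_add, Finset.sum_add_distrib]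
        abel }
  let Y : Sample F K G L LS →+ (∀ _ : {i : Fin K // i ≠ k}, (Fin L → F)) :=
    { toFun := fun ω i => input i.1 ω
      map_zero' := rfl
      map_add' := fun _ _ => rfl }
  let Z : Sample F K G L LS →+ ((Fin L → F) × (Fin L → F) × IndivKey F K G LS k ×
      (∀ i : {i : Fin K // i ∈ 𝒯}, (Fin L → F) × IndivKey F K G LS i.1)) :=
    { toFun := fun ω => (inputSum ω, input k ω, indivKey k ω,
        fun i : {i : Fin K // i ∈ 𝒯} => (input i.1 ω, indivKey i.1 ω))
      map_zero' := by
        refine Prod.ext ?_ rfl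
        simp [inputSum, input]
      map_add' := fun ω ω' => by
        refine Prod.ext ?_ rfl
        simp [inputSum, input, Finset.sum_add_distrib] }
  refine condMutualInfo_eq_zero_of_addMonoidHom X Y Z fun ω hω => ?_
  obtain ⟨h1, h2, h3, h4⟩ : inputSum ω = 0 ∧ input k ω = 0 ∧ indivKey k ω = 0 ∧
      (fun i : {i : Fin K // i ∈ 𝒯} => (input i.1 ω, indivKey i.1 ω)) = 0 := by
    simpa [Z] using hω
  set U : Finset (Fin K) := (insert k 𝒯)ᶜ with hU
  have hUcard : K - T - 1 ≤ U.card := by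
    rw [hU, Finset.card_compl, Finset.card_insert_of_notMem hk, Fintype.card_fin]
    omega
  have hout : ∀ i, i ∉ U → input i ω = 0 ∧ indivKey i ω = 0 := by
    intro i hi
    simp only [hU, Finset.mem_compl, not_not, Finset.mem_insert] at hi
    rcases hi with rfl | hi
    · exact ⟨h2, h3⟩
    · exact Prod.ext_iff.1 (congrFun h4 ⟨i, hi⟩)
  obtain ⟨s, hs0, hs⟩ := hspan U hUcard (fun i => (Scheme.masking B).message i ω)
    (fun i hi => by
      rw [Scheme.message, (hout i hi).1, (hout i hi).2]
      simp [Scheme.masking])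
    (by
      simp only [Scheme.masking_message hB, Finset.sum_add_distrib]
      rw [Finset.sum_comm]
      simpa [hsum, inputSum, input] using h1)
  have hs0' : ∀ i, i ∉ U → ∀ 𝒢 : UserGroup K G, i ∈ 𝒢.1 → s 𝒢 = 0 :=
    fun i hi 𝒢 h𝒢 => hs0 𝒢 fun h => hi (h h𝒢)
  refine ⟨(0, s), ?_, rfl, ?_⟩
  · refine Prod.ext ?_ (Prod.ext rfl (Prod.ext ?_ ?_))
    · simp [Z, inputSum, input]
    · exact funext fun 𝒢 => hs0' k (by simp [hU]) 𝒢.1 𝒢.2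
    · exact funext fun i => Prod.ext rfl
        (funext fun 𝒢 => hs0' i.1 (by simp [hU, i.2]) 𝒢.1 𝒢.2)
  · funext i
    change (Scheme.masking B).message i.1 (0, s) = (Scheme.masking B).message i.1 ω
    rw [Scheme.masking_message hB]
    simpa using hs i.1

end LinearScheme

/-! ### A design of stars and groups -/

section Design

lemma exists_equiv_prod_of_card_fiber {D B M : Type*} [Fintype D] [Fintype M] [DecidableEq B]
    (g : D → B) (h : ∀ b, Fintype.card {d // g d = b} = Fintype.card M) :
    ∃ e : D ≃ B × M, ∀ d, (e d).1 = g d :=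
  ⟨(Equiv.sigmaFiberEquiv g).symm.trans
    ((Equiv.sigmaCongrRight fun b => Fintype.equivOfCardEq (h b)).trans (Equiv.sigmaEquivProd B M)),
    fun _ => rfl⟩

variable {K G : ℕ}

lemma card_groups_between {U : Finset (Fin K)} {q p : Fin K} (hq : q ∈ U) (hp : p ∈ U)
    (hqp : q ≠ p) (hG : 2 ≤ G) :
    Fintype.card {𝒢 : UserGroup K G // 𝒢.1 ⊆ U ∧ q ∈ 𝒢.1 ∧ p ∈ 𝒢.1} =
      (U.card - 2).choose (G - 2) := by
  have hsub : ({q, p} : Finset (Fin K)) ⊆ U := by simp [Finset.insert_subset_iff, hq, hp]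
  rw [← Finset.card_pair hqp, ← Finset.card_sdiff_of_subset hsub, ← Finset.card_powersetCard,
    Finset.card_pair hqp, ← Fintype.card_coe]
  refine Fintype.card_congr
    ⟨fun 𝒢 => ⟨𝒢.1.1 \ {q, p}, ?_⟩, fun s => ⟨⟨s.1 ∪ {q, p}, ?_⟩, ?_⟩, ?_, ?_⟩
  · have h : ({q, p} : Finset (Fin K)) ⊆ 𝒢.1.1 := by
      simp [Finset.insert_subset_iff, 𝒢.2.2.1, 𝒢.2.2.2]
    rw [Finset.mem_powersetCard, Finset.card_sdiff_of_subset h, Finset.card_pair hqp, 𝒢.1.2]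
    exact ⟨Finset.sdiff_subset_sdiff 𝒢.2.1 subset_rfl, rfl⟩
  · have h := Finset.mem_powersetCard.1 s.2
    rw [Finset.card_union_of_disjoint
      (Finset.disjoint_of_subset_left h.1 Finset.sdiff_disjoint), h.2, Finset.card_pair hqp]
    omega
  · have h := Finset.mem_powersetCard.1 s.2
    refine ⟨Finset.union_subset (h.1.trans Finset.sdiff_subset) hsub, ?_, ?_⟩ <;> simp
  · intro 𝒢
    have h : ({q, p} : Finset (Fin K)) ⊆ 𝒢.1.1 := by
      simp [Finset.insert_subset_iff, 𝒢.2.2.1, 𝒢.2.2.2]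
    exact Subtype.ext (Subtype.ext (Finset.sdiff_union_of_subset h))
  · intro s
    have h := Finset.mem_powersetCard.1 s.2
    exact Subtype.ext (Finset.union_sdiff_cancel_right
      (Finset.disjoint_of_subset_left h.1 Finset.sdiff_disjoint))

/-- Indices of the symbols of an input block: a centre and one of the groups containing a given
edge. -/
abbrev InputIndex (u G : ℕ) : Type := Fin u × Fin ((u - 2).choose (G - 2))

/-- Indices of the symbols of a key block: ordered pairs of distinct members of the group. -/
abbrev KeyIndex (G : ℕ) : Type := {c : Fin G × Fin G // c.1 ≠ c.2}

lemma card_keyIndex (G : ℕ) : Fintype.card (KeyIndex G) = G * (G - 1) := by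
  rw [Fintype.card_subtype, show (Finset.univ.filter fun c : Fin G × Fin G => c.1 ≠ c.2) =
    (Finset.univ : Finset (Fin G)).offDiag by ext; simp, Finset.offDiag_card]
  simp [Nat.mul_sub]

/-- Double counting of the triples `(𝒢, q, p)` with `q ≠ p` in `𝒢 ⊆ U`, made explicit.
For each index `ℓ` the pairs `(q, ℓ)` are the edges `q - center ℓ` of a star on `U`; the key
symbols of the groups inside `U` are matched with all these edges, each edge lying inside the
group it is matched with. -/
lemma exists_star_design (hG : 2 ≤ G) {u : ℕ} {U : Finset (Fin K)} (hU : U.card = u) :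
    ∃ (center : InputIndex u G → Fin K)
      (e : {r : Fin K × InputIndex u G // r.1 ∈ U ∧ r.1 ≠ center r.2} ≃
        {𝒢 : UserGroup K G // 𝒢.1 ⊆ U} × KeyIndex G),
      ∀ r, r.1.1 ∈ (e r).1.1.1 ∧ center r.1.2 ∈ (e r).1.1.1 := by
  classical
  let f : Fin u ≃ U := (Fintype.equivFinOfCardEq (by simp [hU])).symm
  let D := {t : UserGroup K G × Fin K × Fin K //
    t.1.1 ⊆ U ∧ t.2.1 ∈ t.1.1 ∧ t.2.2 ∈ t.1.1 ∧ t.2.1 ≠ t.2.2}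
  let P := {t : Fin K × Fin K // t.1 ∈ U ∧ t.2 ∈ U ∧ t.1 ≠ t.2}
  obtain ⟨e₁, he₁⟩ := exists_equiv_prod_of_card_fiber (M := Fin ((u - 2).choose (G - 2)))
    (fun d : D => (⟨d.1.2, d.2.1 d.2.2.1, d.2.1 d.2.2.2.1, d.2.2.2.2⟩ : P)) (by
      rintro ⟨⟨q, p⟩, hq, hp, hqp⟩
      rw [Fintype.card_fin, ← hU, ← card_groups_between hq hp hqp hG]
      refine Fintype.card_congr ⟨fun d => ⟨d.1.1.1, d.1.2.1, ?_, ?_⟩,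
        fun 𝒢 => ⟨⟨(𝒢.1, q, p), 𝒢.2.1, 𝒢.2.2.1, 𝒢.2.2.2, hqp⟩, rfl⟩, ?_, fun _ => rfl⟩
      · have hd : d.1.1.2.1 = q := congrArg (fun t : P => t.1.1) d.2
        have h := d.1.2.2.1
        rwa [hd] at h
      · have hd : d.1.1.2.2 = p := congrArg (fun t : P => t.1.2) d.2
        have h := d.1.2.2.2.1
        rwa [hd] at h
      · rintro ⟨⟨⟨𝒢, q', p'⟩, h⟩, hd⟩
        obtain ⟨rfl, rfl⟩ := Prod.mk.inj (congrArg Subtype.val hd)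
        rfl)
  obtain ⟨e₂, he₂⟩ := exists_equiv_prod_of_card_fiber (M := KeyIndex G)
    (fun d : D => (⟨d.1.1, d.2.1⟩ : {𝒢 : UserGroup K G // 𝒢.1 ⊆ U})) (by
      rintro ⟨𝒢, h𝒢⟩
      have hc : Fintype.card {t : Fin K × Fin K // t ∈ 𝒢.1.offDiag} =
          Fintype.card (KeyIndex G) := by
        rw [Fintype.card_coe, Finset.offDiag_card, 𝒢.2, card_keyIndex, Nat.mul_sub, mul_one]
      rw [← hc]
      refine Fintype.card_congr ⟨fun d => ⟨d.1.1.2, ?_⟩,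
        fun t => ⟨⟨(𝒢, t.1), h𝒢, Finset.mem_offDiag.1 t.2⟩, rfl⟩, ?_, fun _ => rfl⟩
      · have hd : d.1.1.1 = 𝒢 := congrArg Subtype.val d.2
        have h := d.1.2.2
        rw [hd] at h
        exact Finset.mem_offDiag.2 h
      · rintro ⟨⟨⟨𝒢', t⟩, h⟩, hd⟩
        obtain rfl := congrArg Subtype.val hd
        rfl)
  let e₀ : {r : Fin K × InputIndex u G // r.1 ∈ U ∧ r.1 ≠ (f r.2.1 : Fin K)} ≃
      P × Fin ((u - 2).choose (G - 2)) :=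
    { toFun := fun r => (⟨(r.1.1, f r.1.2.1), r.2.1, (f r.1.2.1).2, r.2.2⟩, r.1.2.2)
      invFun := fun t => ⟨(t.1.1.1, (f.symm ⟨t.1.1.2, t.1.2.2.1⟩, t.2)), t.1.2.1, by
        simpa using t.1.2.2.2⟩
      left_inv := fun r => by simp
      right_inv := fun t => by simp }
  refine ⟨fun ℓ => f ℓ.1, e₀.trans (e₁.symm.trans e₂), fun r => ?_⟩
  set d := e₁.symm (e₀ r) with hd
  have h1 : ((e₀.trans (e₁.symm.trans e₂)) r).1.1 = d.1.1 := congrArg Subtype.val (he₂ d)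
  have h2 : d.1.2 = (r.1.1, (f r.1.2.1 : Fin K)) := by
    have := congrArg Subtype.val (he₁ d)
    rw [hd, e₁.apply_symm_apply] at this
    exact this.symm
  rw [h1]
  have h3 := d.2.2.1
  have h4 := d.2.2.2.1
  rw [h2] at h3 h4
  exact ⟨h3, h4⟩

end Design

/-! ### Generic key coefficients -/

section GenericCoefficients

variable {K G u : ℕ}

/-- The free parameters of the key coefficients: one for every group, ordered pair of users, input
symbol and key symbol. -/
abbrev CoeffVar (K G u : ℕ) : Type :=
  UserGroup K G × Fin K × Fin K × InputIndex u G × KeyIndex G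

/-- The coefficient with which symbol `c` of the key of `𝒢` enters symbol `ℓ` of the message of
user `i`. The antisymmetrization in the two users makes the coefficients of each key symbol sum
to zero over the users, for every value of the parameters. -/
def keyCoeff {S : Type*} [CommRing S] (y : CoeffVar K G u → S) (i : Fin K) (𝒢 : UserGroup K G) :
    Matrix (InputIndex u G) (KeyIndex G) S := fun ℓ c =>
  if i ∈ 𝒢.1 then ∑ j ∈ 𝒢.1, (y (𝒢, i, j, ℓ, c) - y (𝒢, j, i, ℓ, c)) else 0

lemma keyCoeff_of_notMem {S : Type*} [CommRing S] (y : CoeffVar K G u → S) {i : Fin K}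
    {𝒢 : UserGroup K G} (h : i ∉ 𝒢.1) : keyCoeff y i 𝒢 = 0 := by
  ext ℓ c
  simp [keyCoeff, h]

lemma sum_keyCoeff {S : Type*} [CommRing S] (y : CoeffVar K G u → S) (𝒢 : UserGroup K G) :
    ∑ i, keyCoeff y i 𝒢 = 0 := by
  ext ℓ c
  rw [Matrix.sum_apply]
  simp only [keyCoeff, Finset.sum_ite_mem, Finset.univ_inter, Finset.sum_sub_distrib]
  rw [Finset.sum_comm, sub_self]
  rfl

lemma map_keyCoeff {S S' : Type*} [CommRing S] [CommRing S'] (φ : S →+* S')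
    (y : CoeffVar K G u → S) (i : Fin K) (𝒢 : UserGroup K G) (ℓ : InputIndex u G)
    (c : KeyIndex G) : φ (keyCoeff y i 𝒢 ℓ c) = keyCoeff (fun t => φ (y t)) i 𝒢 ℓ c := by
  unfold keyCoeff
  split_ifs <;> simp

variable {U : Finset (Fin K)} {center : InputIndex u G → Fin K}

/-- The matrix from the key symbols of the groups inside `U` to the key parts of the messages of
the users in `U`, where for each symbol `ℓ` the row of user `center ℓ`, redundant because of the
zero sum, is dropped. The matching `e` turns it into a square matrix. -/
def keyMatrix {S : Type*} [CommRing S]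
    (e : {r : Fin K × InputIndex u G // r.1 ∈ U ∧ r.1 ≠ center r.2} ≃
      {𝒢 : UserGroup K G // 𝒢.1 ⊆ U} × KeyIndex G) (y : CoeffVar K G u → S) :
    Matrix {r : Fin K × InputIndex u G // r.1 ∈ U ∧ r.1 ≠ center r.2}
      {r : Fin K × InputIndex u G // r.1 ∈ U ∧ r.1 ≠ center r.2} S :=
  fun r r' => keyCoeff y r.1.1 (e r').1.1 r.1.2 (e r').2

variable {e : {r : Fin K × InputIndex u G // r.1 ∈ U ∧ r.1 ≠ center r.2} ≃
      {𝒢 : UserGroup K G // 𝒢.1 ⊆ U} × KeyIndex G}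

/-- Letting each key symbol act along the single edge matched with it gives the identity. -/
lemma exists_keyMatrix_eq_one (S : Type*) [CommRing S]
    (he : ∀ r, r.1.1 ∈ (e r).1.1.1 ∧ center r.1.2 ∈ (e r).1.1.1) :
    ∃ y : CoeffVar K G u → S, keyMatrix e y = 1 := by
  classical
  refine ⟨fun t => if ∃ r, t = ((e r).1.1, r.1.1, center r.1.2, r.1.2, (e r).2) then 1 else 0, ?_⟩
  have key : ∀ r' i j ℓ,
      (∃ r, ((e r').1.1, i, j, ℓ, (e r').2) =
        ((e r).1.1, r.1.1, center r.1.2, r.1.2, (e r).2)) ↔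
        i = r'.1.1 ∧ j = center r'.1.2 ∧ ℓ = r'.1.2 := by
    intro r' i j ℓ
    constructor
    · rintro ⟨r, hr⟩
      simp only [Prod.mk.injEq] at hr
      obtain ⟨h1, h2, h3, h4, h5⟩ := hr
      obtain rfl : r' = r := e.injective (Prod.ext (Subtype.ext h1) h5)
      exact ⟨h2, h3, h4⟩
    · rintro ⟨rfl, rfl, rfl⟩
      exact ⟨r', rfl⟩
  ext r r'
  simp only [keyMatrix, keyCoeff, key, Matrix.one_apply]
  have h1 : ∀ j, ¬ (j = r'.1.1 ∧ r.1.1 = center r'.1.2 ∧ r.1.2 = r'.1.2) := by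
    rintro j ⟨-, h2, h3⟩
    exact r.2.2 (by rw [h2, h3])
  simp only [h1, if_false, sub_zero]
  by_cases h : r = r'
  · subst h
    rw [if_pos (he r).1, if_pos rfl]
    simp [(he r).2]
  · have h2 : ∀ j, ¬ (r.1.1 = r'.1.1 ∧ j = center r'.1.2 ∧ r.1.2 = r'.1.2) := by
      rintro j ⟨h2, -, h3⟩
      exact h (Subtype.ext (Prod.ext h2 h3))
    simp [h2, h]

/-- The key part of the messages, as additive maps of the key blocks. -/
def keyMap {S : Type*} [CommRing S] (y : CoeffVar K G u → S) (i : Fin K) (𝒢 : UserGroup K G) :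
    (KeyIndex G → S) →+ (InputIndex u G → S) :=
  (keyCoeff y i 𝒢).mulVecLin.toAddMonoidHom

lemma keyMap_apply {S : Type*} [CommRing S] (y : CoeffVar K G u → S) (i : Fin K)
    (𝒢 : UserGroup K G) (x : KeyIndex G → S) (ℓ : InputIndex u G) :
    keyMap y i 𝒢 x ℓ = ∑ c, keyCoeff y i 𝒢 ℓ c * x c := rfl

lemma sum_keyMap {S : Type*} [CommRing S] (y : CoeffVar K G u → S) (𝒢 : UserGroup K G)
    (x : KeyIndex G → S) : ∑ i, keyMap y i 𝒢 x = 0 := by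
  have : ∑ i, keyMap y i 𝒢 x = Matrix.mulVec (∑ i, keyCoeff y i 𝒢) x := by
    rw [Matrix.sum_mulVec]
    rfl
  rw [this, sum_keyCoeff, Matrix.zero_mulVec]

lemma keysSpan_of_det_ne_zero {E : Type*} [Field E] {y : CoeffVar K G u → E}
    (hdet : (keyMatrix e y).det ≠ 0) : KeysSpan (keyMap y) U := by
  classical
  intro v hv hsum
  obtain ⟨x, hx⟩ : ∃ x, (keyMatrix e y).mulVec x = fun r => v r.1.1 r.1.2 :=
    ⟨(keyMatrix e y)⁻¹.mulVec fun r => v r.1.1 r.1.2, by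
      rw [Matrix.mulVec_mulVec, Matrix.mul_nonsing_inv _ (isUnit_iff_ne_zero.2 hdet),
        Matrix.one_mulVec]⟩
  let s : UserGroup K G → KeyIndex G → E := fun 𝒢 c =>
    if h : 𝒢.1 ⊆ U then x (e.symm (⟨𝒢, h⟩, c)) else 0
  have hs0 : ∀ 𝒢 : UserGroup K G, ¬ 𝒢.1 ⊆ U → s 𝒢 = 0 := fun 𝒢 h => by
    funext c
    simp [s, h]
  have hrow : ∀ i ℓ, i ∈ U → i ≠ center ℓ → (∑ 𝒢, keyMap y i 𝒢 (s 𝒢)) ℓ = v i ℓ := by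
    intro i ℓ hi hiℓ
    have h1 := congrFun hx ⟨(i, ℓ), hi, hiℓ⟩
    simp only at h1
    rw [← h1, Finset.sum_apply]
    have h2 : ∀ 𝒢, keyMap y i 𝒢 (s 𝒢) ℓ = ∑ c, keyCoeff y i 𝒢 ℓ c * s 𝒢 c := fun _ => rfl
    simp only [h2]
    rw [← Finset.sum_subset (Finset.subset_univ (Finset.univ.filter fun 𝒢 : UserGroup K G =>
      𝒢.1 ⊆ U)) (fun 𝒢 _ h => by
        rw [hs0 𝒢 (by simpa using h)]
        simp)]
    rw [Finset.sum_subtype (p := fun 𝒢 : UserGroup K G => 𝒢.1 ⊆ U) _ (by simp)]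
    rw [← Fintype.sum_prod_type'
      (f := fun (𝒢 : {𝒢 : UserGroup K G // 𝒢.1 ⊆ U}) c => keyCoeff y i 𝒢.1 ℓ c * s 𝒢.1 c),
      ← e.sum_comp]
    refine Finset.sum_congr rfl fun r _ => ?_
    have h3 : s (e r).1.1 (e r).2 = x r := by
      simp only [s, dif_pos (e r).1.2]
      exact congrArg x (e.symm_apply_apply r)
    rw [h3]
    rfl
  have hout : ∀ i, i ∉ U → ∑ 𝒢, keyMap y i 𝒢 (s 𝒢) = 0 := by
    refine fun i hi => Finset.sum_eq_zero fun 𝒢 _ => ?_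
    by_cases h : 𝒢.1 ⊆ U
    · funext ℓ
      simp [keyMap_apply, keyCoeff_of_notMem y fun h' => hi (h h')]
    · rw [hs0 𝒢 h, map_zero]
  have htotal : ∑ i, ∑ 𝒢, keyMap y i 𝒢 (s 𝒢) = 0 := by
    rw [Finset.sum_comm]
    exact Finset.sum_eq_zero fun 𝒢 _ => sum_keyMap y 𝒢 _
  have hne : ∀ i ℓ, i ≠ center ℓ → (∑ 𝒢, keyMap y i 𝒢 (s 𝒢)) ℓ = v i ℓ := by
    intro i ℓ hi
    by_cases hiU : i ∈ U
    · exact hrow i ℓ hiU hi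
    · rw [hout i hiU, hv i hiU]
  refine ⟨s, hs0, fun i => funext fun ℓ => ?_⟩
  by_cases hi : i = center ℓ
  · -- The row that was dropped is recovered from the zero sums.
    have h1 := congrFun htotal ℓ
    have h2 := congrFun hsum ℓ
    rw [Finset.sum_apply, ← Finset.add_sum_erase _ _ (Finset.mem_univ i)] at h1 h2
    rw [Finset.sum_congr rfl fun j hj =>
      hne j ℓ fun h => Finset.ne_of_mem_erase hj (h.trans hi.symm)] at h1
    exact add_right_cancel (h1.trans h2.symm)
  · exact hne i ℓ hi

universe v

lemma exists_finiteDimensional_aeval_ne_zero {F : Type v} [Field F] {V : Type*} [Finite V]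
    {P : MvPolynomial V F} (hP : P ≠ 0) :
    ∃ (E : Type v) (_ : Field E) (_ : Algebra F E) (_ : FiniteDimensional F E) (y : V → E),
      MvPolynomial.aeval y P ≠ 0 := by
  obtain ⟨y, hy⟩ : ∃ y : V → AlgebraicClosure F, MvPolynomial.aeval y P ≠ 0 := by
    by_contra! h
    refine hP ((MvPolynomial.map_injective _
      (algebraMap F (AlgebraicClosure F)).injective) ?_)
    rw [map_zero]
    refine MvPolynomial.funext fun y => ?_
    rw [MvPolynomial.eval_map, ← MvPolynomial.aeval_def, h, map_zero]
  let E := IntermediateField.adjoin F (Set.range y)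
  refine ⟨E, inferInstance, inferInstance, IntermediateField.finiteDimensional_adjoin
    fun x _ => Algebra.IsIntegral.isIntegral x,
    fun t => ⟨y t, IntermediateField.subset_adjoin _ _ ⟨t, rfl⟩⟩, fun h => hy ?_⟩
  have := MvPolynomial.aeval_algebraMap_apply (AlgebraicClosure F)
    (fun t => (⟨y t, IntermediateField.subset_adjoin _ _ ⟨t, rfl⟩⟩ : E)) P
  rw [h, map_zero] at this
  exact this

/-- Over a suitable finite extension, one choice of coefficients serves all `U` at once: the
product of the determinants of the key matrices is a nonzero polynomial in the parameters. -/
lemma exists_keyMap_keysSpan (F : Type v) [Field F] (K : ℕ) (hG : 2 ≤ G) :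
    ∃ (E : Type v) (_ : Field E) (_ : Algebra F E) (_ : FiniteDimensional F E)
      (y : CoeffVar K G u → E), ∀ U : Finset (Fin K), U.card = u → KeysSpan (keyMap y) U := by
  classical
  choose center e he using fun U : {U : Finset (Fin K) // U.card = u} =>
    exists_star_design hG U.2
  have hD : ∀ U, (keyMatrix (e U) (MvPolynomial.X (R := F))).det ≠ 0 := by
    intro U h
    obtain ⟨y, hy⟩ := exists_keyMatrix_eq_one F (he U)
    have h1 := congrArg (MvPolynomial.eval y) h
    rw [RingHom.map_det, map_zero] at h1
    have h2 : (keyMatrix (e U) y).det = 1 := by rw [hy, Matrix.det_one]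
    refine one_ne_zero (α := F) ?_
    rw [← h1, ← h2]
    congr 1
    ext r r'
    simp [keyMatrix, map_keyCoeff]
  obtain ⟨E, iE, iA, iF, y, hy⟩ := exists_finiteDimensional_aeval_ne_zero
    (P := ∏ U, (keyMatrix (e U) (MvPolynomial.X (R := F))).det)
    (Finset.prod_ne_zero_iff.2 fun U _ => hD U)
  refine ⟨E, iE, iA, iF, y, fun U hU => keysSpan_of_det_ne_zero (e := e ⟨U, hU⟩) ?_⟩
  rw [map_prod] at hy
  have h1 := Finset.prod_ne_zero_iff.1 hy ⟨U, hU⟩ (Finset.mem_univ _)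
  rw [AlgHom.map_det] at h1
  convert h1 using 2
  ext r r'
  have := map_keyCoeff (MvPolynomial.aeval (R := F) y).toRingHom MvPolynomial.X r.1.1
    (e ⟨U, hU⟩ r').1.1 r.1.2 (e ⟨U, hU⟩ r').2
  simp only [AlgHom.toRingHom_eq_coe, RingHom.coe_coe, MvPolynomial.aeval_X] at this
  exact this.symm

end GenericCoefficients

/-! ### Achievability over the original field -/

section Achievability

lemma KeysSpan.congr {M N M' N' : Type*} [AddCommGroup M] [AddCommGroup N] [AddCommGroup M']
    [AddCommGroup N'] {K G : ℕ} {B : Fin K → UserGroup K G → M →+ N} {U : Finset (Fin K)}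
    (h : KeysSpan B U) (ψ : M' ≃+ M) (φ : N' ≃+ N) :
    KeysSpan (fun i 𝒢 => (φ.symm.toAddMonoidHom.comp (B i 𝒢)).comp ψ.toAddMonoidHom) U := by
  intro v hv hsum
  obtain ⟨s, hs0, hs⟩ := h (fun i => φ (v i)) (fun i hi => by rw [hv i hi, map_zero])
    (by rw [← map_sum, hsum, map_zero])
  refine ⟨fun 𝒢 => ψ.symm (s 𝒢), fun 𝒢 h𝒢 => by simp [hs0 𝒢 h𝒢], fun i => ?_⟩
  have := congrArg φ.symm (hs i)
  rw [map_sum, AddEquiv.symm_apply_apply] at this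
  simpa using this

lemma card_inputIndex_mul {u G : ℕ} (hG : 2 ≤ G) (hu : G ≤ u) :
    Fintype.card (KeyIndex G) * u.choose G = (u - 1) * Fintype.card (InputIndex u G) := by
  obtain ⟨g, rfl⟩ := Nat.exists_eq_add_of_le' hG
  obtain ⟨w, rfl⟩ := Nat.exists_eq_add_of_le' (hG.trans hu)
  have h1 := Nat.add_one_mul_choose_eq (w + 1) (g + 1)
  have h2 := Nat.add_one_mul_choose_eq w g
  rw [card_keyIndex, Fintype.card_prod, Fintype.card_fin, Fintype.card_fin]
  simp only [Nat.add_sub_cancel, show g + 2 - 1 = g + 1 by omega, show w + 2 - 1 = w + 1 by omega]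
  calc (g + 2) * (g + 1) * (w + 2).choose (g + 2)
      = ((w + 1 + 1).choose (g + 1 + 1) * (g + 1 + 1)) * (g + 1) := by ring
    _ = (w + 2) * ((w + 1).choose (g + 1) * (g + 1)) := by rw [← h1]; ring
    _ = (w + 1) * ((w + 2) * w.choose g) := by rw [← h2]; ring

/-- A secure scheme attaining both optimal rates exactly. -/
lemma exists_scheme (F : Type*) [Field F] [Fintype F] {K T G : ℕ} (hG : 2 ≤ G)
    (hGK : G ≤ K - T - 1) :
    ∃ (L LS : ℕ) (σ : Scheme F K G L L LS), 0 < L ∧ σ.Recovery ∧ σ.Security T ∧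
      LS * (K - T - 1).choose G = (K - T - 2) * L := by
  classical
  set u := K - T - 1 with hu
  obtain ⟨E, _, _, _, y, hy⟩ := exists_keyMap_keysSpan (u := u) F K hG
  set d := Module.finrank F E
  have equiv : ∀ (ι : Type) [Fintype ι],
      Nonempty ((Fin (Fintype.card ι * d) → F) ≃ₗ[F] (ι → E)) := fun ι _ =>
    ⟨LinearEquiv.ofFinrankEq _ _ (by simp [Module.finrank_pi_fintype, d])⟩
  obtain ⟨φ⟩ := equiv (InputIndex u G)
  obtain ⟨ψ⟩ := equiv (KeyIndex G)
  let B := fun i 𝒢 => ((φ.toAddEquiv.symm.toAddMonoidHom.comp (keyMap y i 𝒢)).comp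
    ψ.toAddEquiv.toAddMonoidHom)
  have hB : ∀ k 𝒢, k ∉ 𝒢.1 → B k 𝒢 = 0 := fun k 𝒢 hk => by
    ext1 x
    have : keyMap y k 𝒢 = 0 := by
      ext x ℓ
      simp [keyMap_apply, keyCoeff_of_notMem y hk]
    simp [B, this]
  have hsum : ∀ 𝒢 x, ∑ k, B k 𝒢 x = 0 := fun 𝒢 x => by
    have : ∑ k, B k 𝒢 x = φ.symm (∑ k, keyMap y k 𝒢 (ψ x)) := by
      rw [map_sum]
      rfl
    rw [this, sum_keyMap, map_zero]
  refine ⟨_, _, Scheme.masking B, ?_, Scheme.masking_recovery hB hsum,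
    Scheme.masking_security hB hsum fun U hU => KeysSpan.of_card_le (hG.trans hGK)
      (fun U hU => (hy U hU).congr ψ.toAddEquiv φ.toAddEquiv) hU, ?_⟩
  · have h1 : 0 < (u - 2).choose (G - 2) := Nat.choose_pos (by omega)
    have h2 : 0 < u := by omega
    have h3 : 0 < d := Module.finrank_pos
    rw [Fintype.card_prod, Fintype.card_fin, Fintype.card_fin]
    positivity
  · rw [mul_right_comm, card_inputIndex_mul hG hGK, mul_assoc]
    congr 1

end Achievability

end SecureAgg

theorem theorem1 {F : Type*} [Field F] [Fintype F] (K T G : ℕ)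
    (hK : 3 ≤ K) (hT : T ≤ K - 3) (hG1 : 1 ≤ G) (hGK : G ≤ K) :
    ((G = 1 ∨ K - T ≤ G) → SecureAgg.capacityRegion F K T G = ∅) ∧
    ((2 ≤ G ∧ G < K - T) →
      SecureAgg.capacityRegion F K T G =
        {R : ℝ × ℝ | 1 ≤ R.1 ∧
          ((K : ℝ) - (T : ℝ) - 2) / (Nat.choose (K - T - 1) G : ℝ) ≤ R.2}) := by
  have hcast : ((K - T - 2 : ℕ) : ℝ) = (K : ℝ) - T - 2 := by
    rw [Nat.cast_sub (by omega), Nat.cast_sub (by omega)]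
    simp
  constructor
  · intro h
    rw [SecureAgg.capacityRegion, closure_empty_iff, Set.eq_empty_iff_forall_notMem]
    rintro R ⟨L, LX, LS, σ, hL, hR, hS, -, -⟩
    rcases h with rfl | h
    · exact hS.not_recovery_of_private_keys hK hL hR
    · -- No group avoids a maximal coalition, so no randomness is left to hide the inputs.
      have h1 := hS.le_keyLength hR (by omega)
      rw [Nat.choose_eq_zero_of_lt (by omega), zero_mul] at h1
      have h2 : 0 < (K - T - 2) * L := Nat.mul_pos (by omega) hL
      omega
  · rintro ⟨hG, hGT⟩
    have hC : 0 < ((K - T - 1).choose G : ℝ) := by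
      exact_mod_cast Nat.choose_pos (by omega)
    refine Set.Subset.antisymm (closure_minimal ?_ ?_) fun R hR => subset_closure ?_
    · rintro R ⟨L, LX, LS, σ, hL, hRec, hSec, hX, hS⟩
      have hL' : (0 : ℝ) < L := by exact_mod_cast hL
      refine ⟨le_trans ?_ hX, le_trans ?_ hS⟩
      · rw [le_div_iff₀ hL', one_mul]
        exact_mod_cast hRec.le_messageLength (by omega)
      · rw [div_le_div_iff₀ hC hL', ← hcast, mul_comm (LS : ℝ)]
        exact_mod_cast hSec.le_keyLength hRec (by omega)
    · exact (isClosed_le continuous_const continuous_fst).inter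
        (isClosed_le continuous_const continuous_snd)
    · obtain ⟨L, LS, σ, hL, hRec, hSec, hLS⟩ := SecureAgg.exists_scheme F hG
        (show G ≤ K - T - 1 by omega)
      have hL' : (0 : ℝ) < L := by exact_mod_cast hL
      refine ⟨L, L, LS, σ, hL, hRec, hSec, ?_, le_trans (le_of_eq ?_) hR.2⟩
      · rw [div_self hL'.ne']
        exact hR.1
      · rw [div_eq_div_iff hL'.ne' hC.ne', ← hcast]
        exact_mod_cast hLS
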